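/- Let $R\subset\mathbb R^2$ be a (closed, nondegenerate) rectangle and let $K\subset\mathbb R^2$ be a (closed, filled) convex polygon with exactly $q$ vertices, where $q\ge 6$. Then $K$ cannot tile $R$: for no positive integer $N$ do there exist sets $P_1,\dots,P_N$, each the image of $K$ under an isometry of the plane, with pairwise disjoint interiors and $R=\bigcup_{j=1}^N P_j$. -/

import Mathlib

/-- The Euclidean plane. -/
abbrev Plane : Type := EuclideanSpace ℝ (Fin 2)

/-- `K` is a (closed, filled) convex polygon with exactly `q` vertices: the convex hull of `q` points
of the plane, none of which lies in the convex hull of others. All angles at the vertices are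
thus smaller than `π`. -/
def IsConvexPolygon (q : ℕ) (K : Set Plane) : Prop :=
  3 ≤ q ∧ ∃ v : Fin q → Plane, ConvexIndependent ℝ v ∧ K = convexHull ℝ (Set.range v)

/-- `R` is a (closed, filled, nondegenerate) rectangle, in any position: it has a vertex `c` and
two orthogonal nonzero side vectors `a` and `b`. -/
def IsRectangle (R : Set Plane) : Prop :=
  ∃ c a b : Plane, a ≠ 0 ∧ b ≠ 0 ∧ inner ℝ a b = 0 ∧
    R = {x | ∃ s ∈ Set.Icc (0 : ℝ) 1, ∃ t ∈ Set.Icc (0 : ℝ) 1, x = c + s • a + t • b}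

/-- Two plane sets are congruent: an isometry of the plane (possibly orientation-reversing)
maps the first onto the second. -/
def AreCongruent (A B : Set Plane) : Prop :=
  ∃ φ : Plane ≃ᵢ Plane, B = φ '' A

/-- The sets `P j` form a tiling of `Ω`: their union is `Ω` and their interiors are pairwise
disjoint. -/
def IsTiling {N : ℕ} (Ω : Set Plane) (P : Fin N → Set Plane) : Prop :=
  Ω = ⋃ j, P j ∧ ∀ i j, i ≠ j → Disjoint (interior (P i)) (interior (P j))

/-- `K` can tile `Ω`: for some finite number `N` there is a tiling of `Ω` by `N` sets, each
congruent to `K`. -/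
def CanTile (K Ω : Set Plane) : Prop :=
  ∃ (N : ℕ) (P : Fin N → Set Plane), (∀ j, AreCongruent K (P j)) ∧ IsTiling Ω P

/-! Fix a direction `u` parallel to no line through two distinct vertices of tiles. Give each pair
(tile, vertex of it) the weight 2 − 3r, where r counts those of the two rays from the vertex in
directions `u` and `-u` that enter the tile. The total weight is estimated in two ways.

By tiles: r ≥ 1 at every vertex except the two where the functional vanishing on `u` is minimal or
maximal, so a tile contributes at most 2q − 3(q − 2) = 6 − q ≤ 0 (`sum_vertices_le`).

By points: let p be a vertex of some tile but not a corner of the rectangle. If one ray enters a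
tile with vertex p, at least two tiles have vertex p; if both rays do, at least three. Hence p
contributes at least 0 (`three_mul_sum_rayCount_le`). The geometric source is
`notMem_extremePoints_of_mem_interior_union`: two convex sets filling a neighbourhood of p cannot
form a proper angle there. Each of the four corners is a vertex of some tile, and each of the two
directions enters the rectangle from at most one corner (`IsRectangle.exists_corners`), so the
corners contribute at least 4·2 − 3·2 = 2. The total would be both at least 2 and at most 0. -/

/-! ### Rays entering convex sets -/

/-- The ray from `p` in direction `u` meets the interior of `T`. -/
def RayEnters (T : Set Plane) (u p : Plane) : Prop := ∃ t : ℝ, 0 < t ∧ p + t • u ∈ interior T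

/-- Allows two entering rays to be compared at a common parameter, the smaller of the two. -/
theorem Convex.add_smul_mem_interior_of_le {T : Set Plane} (hT : Convex ℝ T) {p u : Plane}
    (hp : p ∈ T) {t s : ℝ} (ht : p + t • u ∈ interior T) (hs : 0 < s) (hst : s ≤ t) :
    p + s • u ∈ interior T := by
  have htpos : 0 < t := hs.trans_le hst
  have h := hT.combo_interior_self_mem_interior ht hp (a := s / t) (b := 1 - s / t)
    (by positivity) (by rw [sub_nonneg, div_le_one htpos]; exact hst) (by ring)
  convert h using 1
  rw [smul_add, smul_smul, div_mul_cancel₀ _ htpos.ne']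
  module

theorem RayEnters.mono {T R : Set Plane} (h : T ⊆ R) {u p : Plane} (hT : RayEnters T u p) :
    RayEnters R u p := by
  obtain ⟨t, ht, hp⟩ := hT
  exact ⟨t, ht, interior_mono h hp⟩

/-- Two convex sets entered by the same ray have a common interior point. -/
theorem RayEnters.not_disjoint {T T' : Set Plane} (hT : Convex ℝ T) (hT' : Convex ℝ T')
    {u p : Plane} (hp : p ∈ T) (hp' : p ∈ T') (h : RayEnters T u p) (h' : RayEnters T' u p) :
    ¬ Disjoint (interior T) (interior T') := by
  obtain ⟨t, ht, h⟩ := h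
  obtain ⟨t', ht', h'⟩ := h'
  have hm : 0 < min t t' := lt_min ht ht'
  exact Set.not_disjoint_iff.2 ⟨_, hT.add_smul_mem_interior_of_le hp h hm (min_le_left _ _),
    hT'.add_smul_mem_interior_of_le hp' h' hm (min_le_right _ _)⟩

theorem rayEnters_of_mem_interior {T : Set Plane} {p : Plane} (hp : p ∈ interior T) (u : Plane) :
    RayEnters T u p := by
  have hc : Filter.Tendsto (fun t : ℝ => p + t • u) (nhdsWithin 0 (Set.Ioi 0)) (nhds p) := by
    have : Continuous fun t : ℝ => p + t • u := by fun_prop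
    simpa using (this.tendsto 0).mono_left nhdsWithin_le_nhds
  obtain ⟨t, h1, h2⟩ := ((hc.eventually (isOpen_interior.mem_nhds hp)).and
    self_mem_nhdsWithin).exists
  exact ⟨t, h2, h1⟩

/-- A point from which both opposite rays enter a convex set is interior to that set. -/
theorem mem_interior_of_rayEnters {T : Set Plane} (hT : Convex ℝ T) {u p : Plane}
    (h : RayEnters T u p) (h' : RayEnters T (-u) p) : p ∈ interior T := by
  obtain ⟨t, ht, h⟩ := h
  obtain ⟨s, hs, h'⟩ := h'
  have := hT.interior h h' (a := s / (s + t)) (b := t / (s + t)) (by positivity) (by positivity)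
    (by field_simp)
  convert this using 1
  have h1 : p = (s / (s + t) + t / (s + t)) • p := by
    rw [← add_div, div_self (by positivity), one_smul]
  rw [smul_add, smul_add, smul_smul, smul_neg, smul_neg, smul_smul]
  nth_rewrite 1 [h1]
  rw [div_mul_eq_mul_div, div_mul_eq_mul_div, mul_comm s t]
  module

/-! ### Extreme points and local coverings -/

theorem eq_zero_of_add_sub_mem {A : Set Plane} {p d : Plane} (hp : p ∈ A.extremePoints ℝ)
    (h1 : p + d ∈ A) (h2 : p - d ∈ A) : d = 0 := by
  have := hp.2 h1 h2 ⟨1 / 2, 1 / 2, by norm_num, by norm_num, by norm_num, by module⟩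
  simpa using this

theorem notMem_interior_of_mem_extremePoints {T : Set Plane} {p : Plane}
    (hp : p ∈ T.extremePoints ℝ) : p ∉ interior T := by
  intro h
  obtain ⟨ε, hε, hb⟩ := Metric.mem_nhds_iff.1 (mem_interior_iff_mem_nhds.1 h)
  obtain ⟨d, hd⟩ := exists_ne (0 : Plane)
  have hn : 0 < ‖d‖ := norm_pos_iff.2 hd
  have hlt : ‖(ε / (2 * ‖d‖)) • d‖ < ε := by
    rw [norm_smul, Real.norm_of_nonneg (by positivity)]
    field_simp
    linarith
  have h0 := eq_zero_of_add_sub_mem hp (d := (ε / (2 * ‖d‖)) • d) (hb (by simpa using hlt))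
    (hb (by simpa [dist_eq_norm] using hlt))
  rcases smul_eq_zero.1 h0 with h0 | h0
  · have : 0 < ε / (2 * ‖d‖) := by positivity
    exact this.ne' h0
  · exact hd h0

/-- A point around which the plane is covered by two closed convex sets, and which is not interior
to the second of them, is not an extreme point of the first. -/
theorem notMem_extremePoints_of_mem_interior_union {A B : Set Plane} (hA : IsClosed A)
    (hB : Convex ℝ B) (hBi : (interior B).Nonempty) {p : Plane} (hp : p ∈ interior (A ∪ B))
    (hpB : p ∉ interior B) : p ∉ A.extremePoints ℝ := by
  intro hext
  obtain ⟨f, hf⟩ := geometric_hahn_banach_open_point hB.interior isOpen_interior hpB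
  have hfB : ∀ x ∈ B, f x ≤ f p := by
    intro x hx
    have hx' : x ∈ closure (interior B) := by
      rw [hB.closure_interior_eq_closure_of_nonempty_interior hBi]
      exact subset_closure hx
    exact closure_minimal (fun y hy => (hf y hy).le)
      (isClosed_le f.continuous continuous_const) hx'
  obtain ⟨z, hz⟩ := hBi
  obtain ⟨d, hdk, hd⟩ := (Submodule.ne_bot_iff _).1
    (LinearMap.ker_ne_bot_of_finrank_lt (f := f.toLinearMap) (by simp))
  have hdf : f d = 0 := hdk
  obtain ⟨ε, hε, hb⟩ := Metric.mem_nhds_iff.1 (mem_interior_iff_mem_nhds.1 hp)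
  -- Near `p`, points of the line f = f p are limits of points with f > f p. Those are outside `B`,
  -- hence in the closed set `A`; so `A` contains a segment centred at `p`.
  have key : ∀ x ∈ Metric.ball p ε, f x = f p → x ∈ A := by
    intro x hx hfx
    have hc : Filter.Tendsto (fun t : ℝ => x + t • (p - z)) (nhdsWithin 0 (Set.Ioi 0))
        (nhds x) := by
      have : Continuous fun t : ℝ => x + t • (p - z) := by fun_prop
      simpa using (this.tendsto 0).mono_left nhdsWithin_le_nhds
    refine hA.mem_of_tendsto hc ?_
    filter_upwards [hc.eventually (Metric.isOpen_ball.mem_nhds hx), self_mem_nhdsWithin]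
      with t ht htpos
    refine (hb ht).resolve_right fun hmem => ?_
    have h1 := hfB _ hmem
    have h2 := hf z hz
    have h3 : 0 < t * (f p - f z) := mul_pos htpos (by linarith)
    simp only [map_add, map_smul, map_sub, smul_eq_mul] at h1
    linarith
  have hn : 0 < ‖d‖ := norm_pos_iff.2 hd
  have hlt : ‖(ε / (2 * ‖d‖)) • d‖ < ε := by
    rw [norm_smul, Real.norm_of_nonneg (by positivity)]
    field_simp
    linarith
  have h0 := eq_zero_of_add_sub_mem hext (d := (ε / (2 * ‖d‖)) • d)
    (key _ (by simpa using hlt) (by simp [hdf]))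
    (key _ (by simpa [dist_eq_norm] using hlt) (by simp [hdf]))
  rcases smul_eq_zero.1 h0 with h0 | h0
  · have : 0 < ε / (2 * ‖d‖) := by positivity
    exact this.ne' h0
  · exact hd h0

/-! ### Vertices of a convex polygon -/

section Polygon

variable {q : ℕ} {v : Fin q → Plane}

theorem interior_convexHull_nonempty_of_convexIndependent (hq : 3 ≤ q)
    (hv : ConvexIndependent ℝ v) : (interior (convexHull ℝ (Set.range v))).Nonempty := by
  rw [interior_convexHull_nonempty_iff_affineSpan_eq_top]
  have hnot : ∀ i j k : Fin q, i ≠ j → j ≠ k → ¬ Wbtw ℝ (v i) (v j) (v k) := by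
    intro i j k hij hjk h
    have hmem := h.mem_segment
    rw [← convexHull_pair] at hmem
    have := hv {i, k} j (by simpa [Set.image_pair] using hmem)
    simp only [Set.mem_insert_iff, Set.mem_singleton_iff] at this
    rcases this with h | h
    · exact hij h.symm
    · exact hjk h
  let i : Fin q := ⟨0, by omega⟩
  let j : Fin q := ⟨1, by omega⟩
  let k : Fin q := ⟨2, by omega⟩
  have hij : i ≠ j := by simp [i, j]
  have hjk : j ≠ k := by simp [j, k]
  have hik : i ≠ k := by simp [i, k]
  have hcol : ¬ Collinear ℝ {v i, v j, v k} := fun hc => by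
    rcases hc.wbtw_or_wbtw_or_wbtw with h | h | h
    · exact hnot _ _ _ hij hjk h
    · exact hnot _ _ _ hjk hik.symm h
    · exact hnot _ _ _ hik.symm hij h
  have hind := affineIndependent_iff_not_collinear_set.2 hcol
  have htop := hind.affineSpan_eq_top_iff_card_eq_finrank_add_one.2 (by simp)
  refine top_unique (htop.symm.le.trans (affineSpan_mono ℝ ?_))
  rintro _ ⟨l, rfl⟩
  fin_cases l <;> simp

/-- Otherwise all extreme points would be among the other vertices, and Krein–Milman would put `v i`
in their hull. -/
theorem ConvexIndependent.mem_extremePoints_convexHull (hv : ConvexIndependent ℝ v) (i : Fin q) :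
    v i ∈ (convexHull ℝ (Set.range v)).extremePoints ℝ := by
  by_contra hi
  have hsub : (convexHull ℝ (Set.range v)).extremePoints ℝ ⊆ v '' {i}ᶜ := by
    intro x hx
    obtain ⟨k, rfl⟩ := extremePoints_convexHull_subset hx
    exact ⟨k, fun h => hi (by rw [Set.mem_singleton_iff] at h; rwa [h] at hx), rfl⟩
  have hkm := closure_convexHull_extremePoints
    (Set.Finite.isCompact_convexHull ℝ (Set.finite_range v)) (convex_convexHull ℝ (Set.range v))
  have hcl : IsClosed (convexHull ℝ (v '' {i}ᶜ)) :=
    Set.Finite.isClosed_convexHull ℝ (Set.toFinite (v '' {i}ᶜ))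
  have hmem : v i ∈ convexHull ℝ (v '' {i}ᶜ) := by
    refine closure_minimal (convexHull_mono hsub) hcl ?_
    rw [hkm]
    exact subset_convexHull ℝ _ ⟨i, rfl⟩
  exact hv _ _ hmem rfl

/-- A vertex at which a linear functional is smaller than at all other vertices is the only
minimum point of that functional on the polygon. -/
theorem lt_of_mem_convexHull_range (f : Plane →L[ℝ] ℝ) {i : Fin q}
    (hi : ∀ k, k ≠ i → f (v i) < f (v k)) {p : Plane} (hp : p ∈ convexHull ℝ (Set.range v))
    (hpi : p ≠ v i) : f (v i) < f p := by
  -- An open half-plane together with one point of its boundary line is convex.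
  have hconv : Convex ℝ {x | x = v i ∨ f (v i) < f x} := by
    intro x hx y hy a b ha hb hab
    rcases ha.eq_or_lt with rfl | ha
    · obtain rfl : b = 1 := by linarith
      simpa using hy
    rcases hb.eq_or_lt with rfl | hb
    · obtain rfl : a = 1 := by linarith
      simpa using hx
    have hsum : f (v i) = a * f (v i) + b * f (v i) := by rw [← add_mul, hab, one_mul]
    simp only [Set.mem_ofPred_eq, map_add, map_smul, smul_eq_mul]
    rcases hx with rfl | hx <;> rcases hy with rfl | hy
    · left; rw [← add_smul, hab, one_smul]
    · right; nlinarith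
    · right; nlinarith
    · right; nlinarith
  have hsub : Set.range v ⊆ {x | x = v i ∨ f (v i) < f x} := by
    rintro _ ⟨k, rfl⟩
    by_cases h : k = i
    · left; rw [h]
    · right; exact hi k h
  exact (convexHull_min hsub hconv hp).resolve_left hpi

end Polygon

/-! ### Generic directions -/

/-- The line through `p` in direction `u` meets the interior of a convex set with nonempty interior
if the functional vanishing on `u` does not attain an extremum over the set at `p`. -/
theorem rayEnters_or_rayEnters_neg {T : Set Plane} (hT : Convex ℝ T)
    (hTi : (interior T).Nonempty) (f : Plane →L[ℝ] ℝ) {u : Plane}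
    (hu : ∀ x, f x = 0 → ∃ t : ℝ, x = t • u) {p : Plane}
    {a b : Plane} (ha : a ∈ T) (hb : b ∈ T) (hap : f a < f p) (hpb : f p < f b) :
    RayEnters T u p ∨ RayEnters T (-u) p := by
  obtain ⟨z, hz⟩ := hTi
  have hlevel : ∃ x ∈ interior T, f x = f p := by
    have aux : ∀ y ∈ T, (f y - f p) * (f z - f p) < 0 → ∃ x ∈ interior T, f x = f p := by
      intro y hy hneg
      have hne : f y - f z ≠ 0 := by
        intro h
        rw [sub_eq_zero.1 h] at hneg
        nlinarith [mul_self_nonneg (f z - f p)]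
      have hsq : 0 < (f y - f z) ^ 2 := by positivity
      -- The weights solve f = f p on the segment from `z` to `y`. The sign of the denominator is
      -- unknown, so positivity is checked after multiplying numerator and denominator by it.
      refine ⟨_, hT.combo_interior_self_mem_interior hz hy
        (a := (f y - f p) / (f y - f z)) (b := (f p - f z) / (f y - f z)) ?_ ?_ ?_, ?_⟩
      · have : 0 < ((f y - f p) * (f y - f z)) / (f y - f z) ^ 2 :=
          div_pos (by nlinarith [mul_self_nonneg (f y - f p)]) hsq
        rwa [sq, mul_div_mul_right _ _ hne] at this
      · have : 0 ≤ ((f p - f z) * (f y - f z)) / (f y - f z) ^ 2 :=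
          div_nonneg (by nlinarith [mul_self_nonneg (f z - f p)]) hsq.le
        rwa [sq, mul_div_mul_right _ _ hne] at this
      · field_simp
        ring
      · simp only [map_add, map_smul, smul_eq_mul]
        field_simp
        ring
    rcases lt_trichotomy (f z) (f p) with h | h | h
    · exact aux b hb (mul_neg_of_pos_of_neg (by linarith) (by linarith))
    · exact ⟨z, hz, h⟩
    · exact aux a ha (mul_neg_of_neg_of_pos (by linarith) (by linarith))
  obtain ⟨x, hx, hfx⟩ := hlevel
  obtain ⟨t, ht⟩ := hu (x - p) (by rw [map_sub, hfx, sub_self])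
  have hxt : x = p + t • u := by rw [← ht]; abel
  rcases lt_trichotomy t 0 with h | h | h
  · right; exact ⟨-t, by linarith, by rwa [neg_smul_neg, ← hxt]⟩
  · left
    rw [h, zero_smul, add_zero] at hxt
    exact rayEnters_of_mem_interior (hxt ▸ hx) u
  · left; exact ⟨t, h, hxt ▸ hx⟩

/-- Some linear functional on the plane is injective on a given finite set, and its kernel is
a line. -/
theorem exists_functional_injOn (S : Finset Plane) :
    ∃ (f : Plane →L[ℝ] ℝ) (u : Plane), (∀ x, f x = 0 → ∃ t : ℝ, x = t • u) ∧
      Set.InjOn f S := by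
  classical
  -- Two points with different second coordinates share a value of x₀ + m x₁ for exactly one m.
  -- Pairs with zero denominator only exclude the harmless value m = 0.
  obtain ⟨m, hm⟩ := Infinite.exists_notMem_finset
    ((S ×ˢ S).image fun xy => (xy.2 0 - xy.1 0) / (xy.1 1 - xy.2 1))
  let f : Plane →L[ℝ] ℝ := EuclideanSpace.proj 0 + m • EuclideanSpace.proj 1
  have hf : ∀ x, f x = x 0 + m * x 1 := fun x => by simp [f]
  refine ⟨f, !₂[-m, 1], fun x hx => ⟨x 1, ?_⟩, ?_⟩
  · rw [hf] at hx
    ext i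
    fin_cases i
    · simp; linarith
    · simp
  · intro x hx y hy hxy
    rw [hf, hf] at hxy
    by_cases h1 : x 1 - y 1 = 0
    · have h0 : x 0 = y 0 := by
        have : x 1 = y 1 := sub_eq_zero.1 h1
        rw [this] at hxy
        linarith
      ext i
      fin_cases i
      · exact h0
      · exact sub_eq_zero.1 h1
    · refine absurd (Finset.mem_image.2 ⟨(x, y), Finset.mem_product.2 ⟨hx, hy⟩, ?_⟩) hm
      rw [div_eq_iff h1]
      linarith

/-! ### Corners of the rectangle -/

/-- The point with coordinates `s`, `t` in the frame with origin `c` and axes `a`, `b`. -/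
def framePoint (c a b : Plane) (s t : ℝ) : Plane := c + s • a + t • b

section Rectangle

variable {c a b : Plane} {R : Set Plane}

/-- Two linear functionals giving the coordinates in an orthogonal frame. -/
theorem exists_frame_coords (ha : a ≠ 0) (hb : b ≠ 0) (hab : inner ℝ a b = (0 : ℝ)) (c : Plane) :
    ∃ f g : Plane →L[ℝ] ℝ, (∀ s t, f (framePoint c a b s t) = f c + s) ∧
      (∀ s t, g (framePoint c a b s t) = g c + t) ∧ f a = 1 ∧ f b = 0 ∧ g a = 0 ∧ g b = 1 := by
  have hba : inner ℝ b a = (0 : ℝ) := by rw [real_inner_comm, hab]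
  have ha' : inner ℝ a a ≠ (0 : ℝ) := by simpa using ha
  have hb' : inner ℝ b b ≠ (0 : ℝ) := by simpa using hb
  let f : Plane →L[ℝ] ℝ := (inner ℝ a a : ℝ)⁻¹ • innerSL ℝ a
  let g : Plane →L[ℝ] ℝ := (inner ℝ b b : ℝ)⁻¹ • innerSL ℝ b
  have hf : ∀ x, f x = (inner ℝ a a : ℝ)⁻¹ * inner ℝ a x := fun x => rfl
  have hg : ∀ x, g x = (inner ℝ b b : ℝ)⁻¹ * inner ℝ b x := fun x => rfl
  have h1 : f a = 1 := by rw [hf, inv_mul_cancel₀ ha']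
  have h2 : f b = 0 := by rw [hf, hab, mul_zero]
  have h3 : g a = 0 := by rw [hg, hba, mul_zero]
  have h4 : g b = 1 := by rw [hg, inv_mul_cancel₀ hb']
  exact ⟨f, g, fun s t => by simp [framePoint, h1, h2], fun s t => by simp [framePoint, h3, h4],
    h1, h2, h3, h4⟩

end Rectangle

theorem endpoint_eq_of_combo {x y s t r : ℝ} (hx : 0 < x) (hy : 0 < y) (hxy : x + y = 1)
    (hs : s ∈ Set.Icc (0 : ℝ) 1) (ht : t ∈ Set.Icc (0 : ℝ) 1) (hr : r = 0 ∨ r = 1)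
    (h : x * s + y * t = r) : s = r := by
  obtain ⟨hs0, hs1⟩ := hs
  obtain ⟨ht0, ht1⟩ := ht
  rcases hr with rfl | rfl
  · have := mul_nonneg hy.le ht0
    have := mul_nonneg hx.le hs0
    have h0 : x * s = 0 := by linarith
    exact (mul_eq_zero.1 h0).resolve_left hx.ne'
  · have h1 := mul_nonneg hy.le (sub_nonneg.2 ht1)
    have h2 := mul_nonneg hx.le (sub_nonneg.2 hs1)
    have h0 : x * (1 - s) = 0 := by nlinarith
    linarith [(mul_eq_zero.1 h0).resolve_left hx.ne']

/-- A lower bound of a nonzero functional on a set is strict on the interior of the set. -/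
theorem lt_of_mem_interior_of_le {R : Set Plane} {f : Plane →L[ℝ] ℝ} {a : Plane} (ha : f a = 1)
    {m : ℝ} (h : ∀ x ∈ R, m ≤ f x) {x : Plane} (hx : x ∈ interior R) : m < f x := by
  have hc : Filter.Tendsto (fun t : ℝ => x - t • a) (nhdsWithin 0 (Set.Ioi 0)) (nhds x) := by
    have : Continuous fun t : ℝ => x - t • a := by fun_prop
    simpa using (this.tendsto 0).mono_left nhdsWithin_le_nhds
  obtain ⟨t, h1, h2⟩ := ((hc.eventually (isOpen_interior.mem_nhds hx)).and
    self_mem_nhdsWithin).exists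
  have h3 := h _ (interior_subset h1)
  have h4 : 0 < t := h2
  simp only [map_sub, map_smul, ha, smul_eq_mul, mul_one] at h3
  linarith

theorem IsRectangle.exists_corners {R : Set Plane} (hR : IsRectangle R) :
    ∃ C : Finset Plane, C.card = 4 ∧ (∀ p, p ∈ C ↔ p ∈ R.extremePoints ℝ) ∧
      (∀ p ∈ R, p ∉ C → ∃ d ≠ 0, p + d ∈ R ∧ p - d ∈ R) ∧
      ∀ u, ∀ p ∈ C, ∀ p' ∈ C, RayEnters R u p → RayEnters R u p' → p = p' := by
  classical
  obtain ⟨c, a, b, ha, hb, hab, hR⟩ := hR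
  obtain ⟨f, g, hf, hg, hfa, hfb, hga, hgb⟩ := exists_frame_coords ha hb hab c
  have hmem : ∀ x, x ∈ R ↔ ∃ s ∈ Set.Icc (0 : ℝ) 1, ∃ t ∈ Set.Icc (0 : ℝ) 1,
      x = framePoint c a b s t := fun x => by rw [hR]; rfl
  have hmem' : ∀ {s t : ℝ}, s ∈ Set.Icc (0 : ℝ) 1 → t ∈ Set.Icc (0 : ℝ) 1 →
      framePoint c a b s t ∈ R := fun hs ht => (hmem _).2 ⟨_, hs, _, ht, rfl⟩
  let E : Finset ℝ := {0, 1}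
  let F : ℝ × ℝ → Plane := fun st => framePoint c a b st.1 st.2
  have hFinj : Function.Injective F := by
    rintro ⟨s, t⟩ ⟨s', t'⟩ h
    have h1 := congrArg f h
    have h2 := congrArg g h
    simp only [F, hf, hg, add_right_inj] at h1 h2
    rw [h1, h2]
  have hE : ∀ s ∈ E, s = 0 ∨ s = 1 := fun s hs => by simpa [E] using hs
  have hEI : ∀ s ∈ E, s ∈ Set.Icc (0 : ℝ) 1 := fun s hs => by
    rcases hE s hs with rfl | rfl <;> simp
  have hnon : ∀ p ∈ R, p ∉ (E ×ˢ E).image F → ∃ d ≠ 0, p + d ∈ R ∧ p - d ∈ R := by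
    intro p hp hpC
    obtain ⟨s, hs, t, ht, rfl⟩ := (hmem p).1 hp
    -- A coordinate that is not an endpoint can move both ways by its distance to the nearer
    -- endpoint.
    have hstep : ∀ r : ℝ, r ∈ Set.Icc (0 : ℝ) 1 → r ∉ E →
        0 < min r (1 - r) ∧ r + min r (1 - r) ∈ Set.Icc (0 : ℝ) 1 ∧
          r - min r (1 - r) ∈ Set.Icc (0 : ℝ) 1 := by
      intro r hr hrE
      simp only [E, Finset.mem_insert, Finset.mem_singleton, not_or] at hrE
      have h0 : 0 < r := lt_of_le_of_ne hr.1 (Ne.symm hrE.1)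
      have h1 : r < 1 := lt_of_le_of_ne hr.2 hrE.2
      have hpos : 0 < min r (1 - r) := lt_min h0 (by linarith)
      have h2 := min_le_left r (1 - r)
      have h3 := min_le_right r (1 - r)
      exact ⟨hpos, ⟨by linarith, by linarith⟩, ⟨by linarith, by linarith⟩⟩
    by_cases hsE : s ∈ E
    · have htE : t ∉ E := fun htE => hpC
        (Finset.mem_image.2 ⟨(s, t), Finset.mem_product.2 ⟨hsE, htE⟩, rfl⟩)
      obtain ⟨h1, h2, h3⟩ := hstep t ht htE
      refine ⟨min t (1 - t) • b, smul_ne_zero h1.ne' hb, ?_, ?_⟩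
      · convert hmem' hs h2 using 1
        simp only [framePoint]; module
      · convert hmem' hs h3 using 1
        simp only [framePoint]; module
    · obtain ⟨h1, h2, h3⟩ := hstep s hs hsE
      refine ⟨min s (1 - s) • a, smul_ne_zero h1.ne' ha, ?_, ?_⟩
      · convert hmem' h2 ht using 1
        simp only [framePoint]; module
      · convert hmem' h3 ht using 1
        simp only [framePoint]; module
  refine ⟨(E ×ˢ E).image F, ?_, fun p => ⟨fun hp => ?_, fun hp => ?_⟩, hnon, ?_⟩
  · rw [Finset.card_image_of_injective _ hFinj, Finset.card_product]
    simp [E]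
  · obtain ⟨⟨s, t⟩, hst, rfl⟩ := Finset.mem_image.1 hp
    obtain ⟨hs, ht⟩ := Finset.mem_product.1 hst
    refine ⟨hmem' (hEI _ hs) (hEI _ ht), ?_⟩
    intro x hx y hy ⟨α, β, hα, hβ, hαβ, hxy⟩
    obtain ⟨s1, hs1, t1, ht1, rfl⟩ := (hmem x).1 hx
    obtain ⟨s2, hs2, t2, ht2, rfl⟩ := (hmem y).1 hy
    have e1 := congrArg f hxy
    have e2 := congrArg g hxy
    simp only [F, map_add, map_smul, hf, hg, smul_eq_mul] at e1 e2
    have k1 : s1 = s := endpoint_eq_of_combo hα hβ hαβ hs1 hs2 (hE _ hs) (by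
      linear_combination e1 - f c * hαβ)
    have k2 : t1 = t := endpoint_eq_of_combo hα hβ hαβ ht1 ht2 (hE _ ht) (by
      linear_combination e2 - g c * hαβ)
    rw [k1, k2]
  · by_contra hpC
    obtain ⟨d, hd, h1, h2⟩ := hnon p hp.1 hpC
    have := hp.2 h1 h2 ⟨1 / 2, 1 / 2, by norm_num, by norm_num, by norm_num, by module⟩
    exact hd (by simpa using this)
  · intro u p hp p' hp' ⟨τ, hτ, hin⟩ ⟨τ', hτ', hin'⟩
    have hlow : ∀ (k : Plane →L[ℝ] ℝ) (w : Plane), k w = 1 → (∀ x ∈ R, k c ≤ k x) →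
        ∀ x ∈ interior R, k c < k x :=
      fun k w hw h x hx => lt_of_mem_interior_of_le hw h hx
    have hupp : ∀ (k : Plane →L[ℝ] ℝ) (w : Plane), k w = 1 → (∀ x ∈ R, k x ≤ k c + 1) →
        ∀ x ∈ interior R, k x < k c + 1 := by
      intro k w hw h x hx
      have := lt_of_mem_interior_of_le (f := -k) (a := -w) (by simp [hw]) (m := -(k c + 1))
        (fun y hy => by have := h y hy; simp; linarith) hx
      simp at this
      linarith
    have hfR : ∀ x ∈ R, f c ≤ f x ∧ f x ≤ f c + 1 := by
      intro x hx
      obtain ⟨s, hs, t, ht, rfl⟩ := (hmem x).1 hx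
      rw [hf]
      exact ⟨by linarith [hs.1], by linarith [hs.2]⟩
    have hgR : ∀ x ∈ R, g c ≤ g x ∧ g x ≤ g c + 1 := by
      intro x hx
      obtain ⟨s, hs, t, ht, rfl⟩ := (hmem x).1 hx
      rw [hg]
      exact ⟨by linarith [ht.1], by linarith [ht.2]⟩
    -- A ray entering from the side with coordinate 0 has k u > 0, from the side with coordinate 1
    -- it has k u < 0; so `u` determines each coordinate of the corner.
    have hcoord : ∀ (k : Plane →L[ℝ] ℝ) (w : Plane), k w = 1 →
        (∀ x ∈ R, k c ≤ k x ∧ k x ≤ k c + 1) → ∀ r r' : ℝ, r ∈ E → r' ∈ E →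
        k p = k c + r → k p' = k c + r' → r = r' := by
      intro k w hw hk r r' hr hr' hkp hkp'
      have l1 := hlow k w hw (fun x hx => (hk x hx).1) _ hin
      have l2 := hlow k w hw (fun x hx => (hk x hx).1) _ hin'
      have u1 := hupp k w hw (fun x hx => (hk x hx).2) _ hin
      have u2 := hupp k w hw (fun x hx => (hk x hx).2) _ hin'
      simp only [map_add, map_smul, smul_eq_mul, hkp, hkp'] at l1 l2 u1 u2
      rcases hE _ hr with rfl | rfl <;> rcases hE _ hr' with rfl | rfl
      · rfl
      · have h1 : 0 < k u := pos_of_mul_pos_right (b := k u) (by linarith : 0 < τ * k u) hτ.le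
        nlinarith
      · have h1 : 0 < k u := pos_of_mul_pos_right (b := k u) (by linarith : 0 < τ' * k u) hτ'.le
        nlinarith
      · rfl
    obtain ⟨⟨s, t⟩, hst, rfl⟩ := Finset.mem_image.1 hp
    obtain ⟨⟨s', t'⟩, hst', rfl⟩ := Finset.mem_image.1 hp'
    obtain ⟨hs, ht⟩ := Finset.mem_product.1 hst
    obtain ⟨hs', ht'⟩ := Finset.mem_product.1 hst'
    rw [hcoord f a hfa hfR s s' hs hs' (hf _ _) (hf _ _),
      hcoord g b hgb hgR t t' ht ht' (hg _ _) (hg _ _)]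

/-! ### Counting entering rays -/

open Classical in
/-- The number (zero or one) of rays from `p` in direction `u` entering `T`. -/
noncomputable def rayCount (T : Set Plane) (u p : Plane) : ℤ := if RayEnters T u p then 1 else 0

theorem rayCount_of_rayEnters {T : Set Plane} {u p : Plane} (h : RayEnters T u p) :
    rayCount T u p = 1 := by simp [rayCount, h]

theorem rayCount_of_not_rayEnters {T : Set Plane} {u p : Plane} (h : ¬ RayEnters T u p) :
    rayCount T u p = 0 := by simp [rayCount, h]

theorem rayCount_nonneg (T : Set Plane) (u p : Plane) : 0 ≤ rayCount T u p := by
  unfold rayCount; split_ifs <;> simp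

theorem rayCount_le_one (T : Set Plane) (u p : Plane) : rayCount T u p ≤ 1 := by
  unfold rayCount; split_ifs <;> simp

/-- If a ray enters at most one member of a finite family of subsets of `R`, the total ray count
of the family is at most that of `R`. -/
theorem sum_rayCount_le {ι : Type*} {J : Finset ι} {T : ι → Set Plane} {R : Set Plane}
    {u p : Plane} (hsub : ∀ j ∈ J, T j ⊆ R)
    (huniq : ∀ i ∈ J, ∀ j ∈ J, RayEnters (T i) u p → RayEnters (T j) u p → i = j) :
    ∑ j ∈ J, rayCount (T j) u p ≤ rayCount R u p := by
  by_cases h : ∃ j ∈ J, RayEnters (T j) u p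
  · obtain ⟨j, hj, hje⟩ := h
    rw [Finset.sum_eq_single_of_mem j hj fun i hi hij =>
      rayCount_of_not_rayEnters fun hie => hij (huniq i hi j hj hie hje),
      rayCount_of_rayEnters hje, rayCount_of_rayEnters (hje.mono (hsub j hj))]
  · push Not at h
    rw [Finset.sum_eq_zero fun j hj => rayCount_of_not_rayEnters (h j hj)]
    exact rayCount_nonneg _ _ _

theorem exists_rayEnters_of_sum_pos {ι : Type*} {J : Finset ι} {T : ι → Set Plane}
    {u p : Plane} (h : 0 < ∑ j ∈ J, rayCount (T j) u p) : ∃ j ∈ J, RayEnters (T j) u p := by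
  by_contra hno
  push Not at hno
  rw [Finset.sum_eq_zero fun j hj => rayCount_of_not_rayEnters (hno j hj)] at h
  exact h.false

/-! ### Tiles around a point -/

/-- In a finite family of closed sets covering `R`, the members containing an interior point `p`
of `R` cover a neighbourhood of `p`. -/
theorem mem_interior_biUnion_of_cover {N : ℕ} {P : Fin N → Set Plane} {R A : Set Plane}
    (hcov : R ⊆ ⋃ j, P j) (hcl : ∀ j, IsClosed (P j)) {p : Plane} (hp : p ∈ interior R)
    (hA : ∀ j, p ∈ P j → P j ⊆ A) : p ∈ interior A := by
  rw [mem_interior_iff_mem_nhds] at hp ⊢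
  have hev : ∀ᶠ x in nhds p, ∀ j, p ∉ P j → x ∉ P j := by
    rw [Filter.eventually_all]
    intro j
    by_cases hj : p ∈ P j
    · exact Filter.Eventually.of_forall fun _ h => absurd hj h
    · filter_upwards [(hcl j).isOpen_compl.mem_nhds hj] with x hx _
      exact hx
  filter_upwards [hp, hev] with x hxR hx
  obtain ⟨j, hj⟩ := Set.mem_iUnion.1 (hcov hxR)
  exact hA j (not_not.1 fun h => hx j h hj) hj

section Tiling

variable {N : ℕ} {P : Fin N → Set Plane} {R : Set Plane}

/-- If a closed convex tile is the only member of a finite closed cover of the convex set `R`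
containing the point `p`, which lies strictly between two points of `R`, then `p` is not
an extreme point of that tile. -/
theorem notMem_extremePoints_of_unique_tile (hR : Convex ℝ R) (hcov : R ⊆ ⋃ j, P j)
    (hcl : ∀ j, IsClosed (P j)) {p d : Plane} (hd : d ≠ 0) (h1 : p + d ∈ R) (h2 : p - d ∈ R)
    {i : Fin N} (hi : ∀ j, p ∈ P j → j = i) : p ∉ (P i).extremePoints ℝ := by
  intro hext
  have hev : ∀ e : Plane, p + e ∈ R → ∀ᶠ t : ℝ in nhdsWithin 0 (Set.Ioi 0), p + t • e ∈ P i := by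
    intro e he
    have hc : Filter.Tendsto (fun t : ℝ => p + t • e) (nhdsWithin 0 (Set.Ioi 0)) (nhds p) := by
      have : Continuous fun t : ℝ => p + t • e := by fun_prop
      simpa using (this.tendsto 0).mono_left nhdsWithin_le_nhds
    have hfar : ∀ᶠ x in nhds p, ∀ j, j ≠ i → x ∉ P j := by
      rw [Filter.eventually_all]
      intro j
      by_cases hj : j = i
      · exact Filter.Eventually.of_forall fun _ h => absurd hj h
      · filter_upwards [(hcl j).isOpen_compl.mem_nhds fun hp => hj (hi j hp)] with x hx _
        exact hx
    have hpR : p ∈ R := by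
      have := hR h1 h2 (a := 1 / 2) (b := 1 / 2) (by norm_num) (by norm_num) (by norm_num)
      convert this using 1
      module
    have hlt : ∀ᶠ t : ℝ in nhdsWithin 0 (Set.Ioi 0), t < 1 :=
      nhdsWithin_le_nhds (Iio_mem_nhds one_pos)
    filter_upwards [hc.eventually hfar, hlt, self_mem_nhdsWithin] with t ht ht1 ht0
    have ht0' : 0 < t := ht0
    have hmem : p + t • e ∈ R := by
      have := hR hpR he (a := 1 - t) (b := t) (by linarith) ht0'.le (by ring)
      convert this using 1
      module
    obtain ⟨j, hj⟩ := Set.mem_iUnion.1 (hcov hmem)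
    by_cases hji : j = i
    · exact hji ▸ hj
    · exact absurd hj (ht j hji)
  obtain ⟨t, ⟨ha, hb⟩, ht⟩ := (((hev d h1).and (hev (-d) (by simpa [sub_eq_add_neg] using h2))).and
    self_mem_nhdsWithin).exists
  have ht0 : 0 < t := ht
  have := eq_zero_of_add_sub_mem hext ha (by simpa [sub_eq_add_neg] using hb)
  exact (smul_ne_zero ht0.ne' hd) this

/-- Among convex tiles with disjoint interiors, at most one containing `p` is entered by
a given ray from `p`. -/
theorem eq_of_rayEnters (hconv : ∀ j, Convex ℝ (P j))
    (hdisj : ∀ i j, i ≠ j → Disjoint (interior (P i)) (interior (P j))) {u p : Plane} {i j : Fin N}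
    (hi : p ∈ P i) (hj : p ∈ P j) (hie : RayEnters (P i) u p) (hje : RayEnters (P j) u p) :
    i = j := by
  by_contra h
  exact hie.not_disjoint (hconv i) (hconv j) hi hj hje (hdisj i j h)

variable (hR : Convex ℝ R) (hcov : R ⊆ ⋃ j, P j) (hcl : ∀ j, IsClosed (P j))
  (hconv : ∀ j, Convex ℝ (P j)) (hint : ∀ j, (interior (P j)).Nonempty)
  (hdisj : ∀ i j, i ≠ j → Disjoint (interior (P i)) (interior (P j)))
  (hsub : ∀ j, P j ⊆ R)

include hR hcov hcl hconv hint hdisj hsub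

/-- At a point strictly inside a segment of `R`, a tile that has this point as extreme point and is
entered by one of the two rays along the given line is not the only tile with this extreme point. -/
theorem one_lt_card_of_rayEnters {p u d : Plane} (hd : d ≠ 0)
    (h1 : p + d ∈ R) (h2 : p - d ∈ R) {J : Finset (Fin N)}
    (hJ : ∀ j, j ∈ J ↔ p ∈ (P j).extremePoints ℝ)
    (hother : ∀ j, p ∈ P j → j ∉ J → RayEnters (P j) u p ∨ RayEnters (P j) (-u) p)
    {i : Fin N} (hi : i ∈ J) (hie : RayEnters (P i) u p) : 1 < J.card := by
  by_contra hcard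
  have hJi : ∀ j ∈ J, j = i := fun j hj => Finset.card_le_one.1 (not_lt.1 hcard) j hj i hi
  have hext := (hJ i).1 hi
  by_cases hex : ∃ k, p ∈ P k ∧ k ≠ i
  · obtain ⟨k, hk, hki⟩ := hex
    -- The ray along `u` is already taken by tile `i`, so every other tile at `p` is entered along
    -- `-u`; hence there is only one such tile.
    have hback : ∀ j, p ∈ P j → j ≠ i → RayEnters (P j) (-u) p := fun j hj hji =>
      (hother j hj fun h => hji (hJi j h)).resolve_left fun h =>
        hji (eq_of_rayEnters hconv hdisj hj hext.1 h hie)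
    have hke := hback k hk hki
    have hpR := mem_interior_of_rayEnters hR (hie.mono (hsub i)) (hke.mono (hsub k))
    refine notMem_extremePoints_of_mem_interior_union (hcl i) (hconv k) (hint k)
      (mem_interior_biUnion_of_cover hcov hcl hpR fun j hj => ?_)
      (fun h => hki (eq_of_rayEnters hconv hdisj hk hext.1 (rayEnters_of_mem_interior h u) hie))
      hext
    by_cases hji : j = i
    · exact hji ▸ Set.subset_union_left
    · rw [eq_of_rayEnters hconv hdisj hj hk (hback j hj hji) hke]
      exact Set.subset_union_right
  · push Not at hex
    exact notMem_extremePoints_of_unique_tile hR hcov hcl hd h1 h2 hex hext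

/-- At least three tiles have `p` as extreme point if such tiles are entered by both rays along
the given line. -/
theorem two_lt_card_of_rayEnters {p u : Plane} {J : Finset (Fin N)}
    (hJ : ∀ j, j ∈ J ↔ p ∈ (P j).extremePoints ℝ)
    (hother : ∀ j, p ∈ P j → j ∉ J → RayEnters (P j) u p ∨ RayEnters (P j) (-u) p)
    {i k : Fin N} (hi : i ∈ J) (hk : k ∈ J) (hie : RayEnters (P i) u p)
    (hke : RayEnters (P k) (-u) p) : 2 < J.card := by
  classical
  have hexti := (hJ i).1 hi
  have hextk := (hJ k).1 hk
  have hki : k ≠ i := by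
    rintro rfl
    exact notMem_interior_of_mem_extremePoints hextk (mem_interior_of_rayEnters (hconv k) hie hke)
  by_contra hcard
  have hJeq : ({k, i} : Finset (Fin N)) = J := Finset.eq_of_subset_of_card_le
    (by simp [Finset.insert_subset_iff, hi, hk]) (by rw [Finset.card_pair hki]; omega)
  have hpR := mem_interior_of_rayEnters hR (hie.mono (hsub i)) (hke.mono (hsub k))
  refine notMem_extremePoints_of_mem_interior_union (hcl i) (hconv k) (hint k)
    (mem_interior_biUnion_of_cover hcov hcl hpR fun j hj => ?_)
    (notMem_interior_of_mem_extremePoints hextk) hexti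
  -- A further tile at `p`, not having it as a vertex, would be entered by a ray already taken by
  -- `i` or `k`.
  have hji : j = k ∨ j = i := by
    by_cases hjJ : j ∈ J
    · simpa [← hJeq] using hjJ
    · rcases hother j hj hjJ with h | h
      · exact Or.inr (eq_of_rayEnters hconv hdisj hj hexti.1 h hie)
      · exact Or.inl (eq_of_rayEnters hconv hdisj hj hextk.1 h hke)
  rcases hji with rfl | rfl
  · exact Set.subset_union_right
  · exact Set.subset_union_left

/-- Local count at a point strictly inside a segment of `R`. -/
theorem three_mul_sum_rayCount_le {p u d : Plane} (hd : d ≠ 0)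
    (h1 : p + d ∈ R) (h2 : p - d ∈ R) {J : Finset (Fin N)}
    (hJ : ∀ j, j ∈ J ↔ p ∈ (P j).extremePoints ℝ)
    (hother : ∀ j, p ∈ P j → j ∉ J → RayEnters (P j) u p ∨ RayEnters (P j) (-u) p) :
    3 * (∑ j ∈ J, rayCount (P j) u p + ∑ j ∈ J, rayCount (P j) (-u) p) ≤ 2 * (J.card : ℤ) := by
  -- Both sums are 0 or 1, so the claim reduces to 3·1 ≤ 2·2 and 3·2 ≤ 2·3.
  have hle : ∀ w, ∑ j ∈ J, rayCount (P j) w p ≤ 1 := fun w =>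
    (sum_rayCount_le (fun j _ => hsub j) fun i hi j hj =>
      eq_of_rayEnters hconv hdisj ((hJ i).1 hi).1 ((hJ j).1 hj).1).trans (rayCount_le_one _ _ _)
  have hX := hle u
  have hY := hle (-u)
  by_cases hx : 0 < ∑ j ∈ J, rayCount (P j) u p
  · obtain ⟨i, hi, hie⟩ := exists_rayEnters_of_sum_pos hx
    by_cases hy : 0 < ∑ j ∈ J, rayCount (P j) (-u) p
    · obtain ⟨k, hk, hke⟩ := exists_rayEnters_of_sum_pos hy
      have := two_lt_card_of_rayEnters hR hcov hcl hconv hint hdisj hsub hJ hother hi hk hie hke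
      omega
    · have := one_lt_card_of_rayEnters hR hcov hcl hconv hint hdisj hsub hd h1 h2 hJ hother hi hie
      omega
  · by_cases hy : 0 < ∑ j ∈ J, rayCount (P j) (-u) p
    · obtain ⟨k, hk, hke⟩ := exists_rayEnters_of_sum_pos hy
      have := one_lt_card_of_rayEnters hR hcov hcl hconv hint hdisj hsub hd h1 h2 hJ
        (fun j hj hjJ => by rw [neg_neg]; exact (hother j hj hjJ).symm) hk hke
      omega
    · omega

end Tiling

/-! ### Double counting over the vertices of all tiles -/

theorem IsConvexPolygon.exists_vertices_of_congruent {q : ℕ} {K T : Set Plane}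
    (hK : IsConvexPolygon q K) (h : AreCongruent K T) :
    ∃ v : Fin q → Plane, ConvexIndependent ℝ v ∧ T = convexHull ℝ (Set.range v) := by
  obtain ⟨-, v, hv, rfl⟩ := hK
  obtain ⟨φ, rfl⟩ := h
  let ψ : Plane ≃ᵃ[ℝ] Plane := φ.toRealAffineIsometryEquiv.toAffineEquiv
  have hφ : ∀ s : Set Plane, φ '' s = (ψ : Plane →ᵃ[ℝ] Plane) '' s := fun s => by
    ext x; simp [ψ]
  have hψ : Function.Injective (ψ : Plane →ᵃ[ℝ] Plane) := ψ.injective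
  refine ⟨(ψ : Plane →ᵃ[ℝ] Plane) ∘ v, fun s i hi => ?_, ?_⟩
  · rw [Set.image_comp, ← AffineMap.image_convexHull] at hi
    exact hv s i (hψ.mem_set_image.1 hi)
  · rw [hφ, AffineMap.image_convexHull, Set.range_comp]

/-- At all vertices of a convex polygon but two, one of two opposite generic rays enters. -/
theorem ConvexIndependent.rayEnters_or_of_ne {q : ℕ} (hq : 3 ≤ q) {v : Fin q → Plane}
    (hv : ConvexIndependent ℝ v) (f : Plane →L[ℝ] ℝ) {u : Plane}
    (hu : ∀ x, f x = 0 → ∃ t : ℝ, x = t • u) (hf : Set.InjOn f (Set.range v)) :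
    ∃ i₀ i₁ : Fin q, ∀ p ∈ convexHull ℝ (Set.range v), p ≠ v i₀ → p ≠ v i₁ →
      RayEnters (convexHull ℝ (Set.range v)) u p ∨
        RayEnters (convexHull ℝ (Set.range v)) (-u) p := by
  have : Nonempty (Fin q) := ⟨⟨0, by omega⟩⟩
  obtain ⟨i₀, hi₀⟩ := Finite.exists_min (f ∘ v)
  obtain ⟨i₁, hi₁⟩ := Finite.exists_max (f ∘ v)
  -- Injectivity makes the minimum and the maximum of `f` strict, each attained at a single vertex.
  have hne : ∀ i k, k ≠ i → f (v i) ≠ f (v k) := fun i k hki h =>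
    hki (hv.injective (hf ⟨i, rfl⟩ ⟨k, rfl⟩ h)).symm
  refine ⟨i₀, i₁, fun p hp h0 h1 => ?_⟩
  have hmem : ∀ i, v i ∈ convexHull ℝ (Set.range v) := fun i => subset_convexHull ℝ _ ⟨i, rfl⟩
  refine rayEnters_or_rayEnters_neg (convex_convexHull ℝ _)
    (interior_convexHull_nonempty_of_convexIndependent hq hv) f hu (hmem i₀) (hmem i₁) ?_ ?_
  · exact lt_of_mem_convexHull_range f (fun k hk => lt_of_le_of_ne (hi₀ k) (hne _ _ hk)) hp h0
  · have := lt_of_mem_convexHull_range (-f) (i := i₁)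
      (fun k hk => neg_lt_neg (lt_of_le_of_ne (hi₁ k) (hne _ _ hk).symm)) hp h1
    exact neg_lt_neg_iff.1 this

theorem IsRectangle.convex {R : Set Plane} (hR : IsRectangle R) : Convex ℝ R := by
  obtain ⟨c, a, b, -, -, -, rfl⟩ := hR
  rintro _ ⟨s, hs, t, ht, rfl⟩ _ ⟨s', hs', t', ht', rfl⟩ x y hx hy hxy
  refine ⟨_, convex_Icc (0 : ℝ) 1 hs hs' hx hy hxy, _, convex_Icc (0 : ℝ) 1 ht ht' hx hy hxy, ?_⟩
  have : c = (x + y) • c := by rw [hxy, one_smul]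
  nth_rewrite 3 [this]
  simp only [smul_eq_mul]
  module

/-- The vertex count of one polygon: at most two vertices are missed by the generic rays. -/
theorem sum_vertices_le {q : ℕ} (hq : 6 ≤ q) {T : Set Plane} {u : Plane} {V : Finset Plane}
    (hV : V.card = q) {a b : Plane}
    (h : ∀ p ∈ V, p ≠ a → p ≠ b → RayEnters T u p ∨ RayEnters T (-u) p) :
    ∑ p ∈ V, (2 - 3 * (rayCount T u p + rayCount T (-u) p)) ≤ 0 := by
  classical
  -- An entering ray brings the weight down to at most 2 − 3 = −1; at `a` and `b` only 2 = −1 + 3 is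
  -- available. The sum is at most −q + 6.
  have hle : ∀ p ∈ V, 2 - 3 * (rayCount T u p + rayCount T (-u) p) ≤
      -1 + 3 * (if p ∈ ({a, b} : Finset Plane) then 1 else 0) := by
    intro p hp
    have h1 := rayCount_nonneg T u p
    have h2 := rayCount_nonneg T (-u) p
    by_cases hpab : p ∈ ({a, b} : Finset Plane)
    · rw [if_pos hpab]; omega
    · rw [if_neg hpab]
      simp only [Finset.mem_insert, Finset.mem_singleton, not_or] at hpab
      rcases h p hp hpab.1 hpab.2 with h | h
      · rw [rayCount_of_rayEnters h]; omega
      · rw [rayCount_of_rayEnters h]; omega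
  refine (Finset.sum_le_sum hle).trans ?_
  rw [Finset.sum_add_distrib, ← Finset.mul_sum, Finset.sum_ite_mem, Finset.sum_const,
    Finset.sum_const, hV]
  have hc : (V ∩ {a, b}).card ≤ 2 := (Finset.card_le_card Finset.inter_subset_right).trans
    Finset.card_le_two
  simp only [nsmul_eq_mul, mul_neg, mul_one]
  omega

theorem theorem1 (q : ℕ) (hq : 6 ≤ q) (R K : Set Plane)
    (hR : IsRectangle R) (hK : IsConvexPolygon q K) :
    ¬ CanTile K R := by
  classical
  rintro ⟨N, P, hcong, htile, hdisj⟩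
  choose v hv hP using fun j => hK.exists_vertices_of_congruent (hcong j)
  have hq3 : 3 ≤ q := by omega
  have hconv : ∀ j, Convex ℝ (P j) := fun j => by rw [hP]; exact convex_convexHull ℝ _
  have hcl : ∀ j, IsClosed (P j) := fun j => by
    rw [hP]; exact Set.Finite.isClosed_convexHull ℝ (Set.finite_range _)
  have hint : ∀ j, (interior (P j)).Nonempty := fun j => by
    rw [hP]; exact interior_convexHull_nonempty_of_convexIndependent hq3 (hv j)
  have hsub : ∀ j, P j ⊆ R := fun j => by rw [htile]; exact Set.subset_iUnion P j
  let V : Fin N → Finset Plane := fun j => Finset.univ.image (v j)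
  have hVcard : ∀ j, (V j).card = q := fun j => by
    rw [Finset.card_image_of_injective _ (hv j).injective, Finset.card_univ, Fintype.card_fin]
  have hVext : ∀ j p, p ∈ V j ↔ p ∈ (P j).extremePoints ℝ := by
    intro j p
    rw [hP]
    constructor
    · intro h
      obtain ⟨i, -, rfl⟩ := Finset.mem_image.1 h
      exact (hv j).mem_extremePoints_convexHull i
    · intro h
      obtain ⟨i, rfl⟩ := extremePoints_convexHull_subset h
      exact Finset.mem_image_of_mem _ (Finset.mem_univ i)
  let S : Finset Plane := Finset.univ.biUnion V
  have hVS : ∀ j, V j ⊆ S := fun j => Finset.subset_biUnion_of_mem V (Finset.mem_univ j)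
  obtain ⟨f, u, hu, hf⟩ := exists_functional_injOn S
  have hrange : ∀ j, Set.range (v j) ⊆ S := by
    rintro j _ ⟨i, rfl⟩
    exact hVS j (Finset.mem_image_of_mem _ (Finset.mem_univ i))
  choose i₀ i₁ henter using fun j =>
    (hv j).rayEnters_or_of_ne hq3 f hu (hf.mono (hrange j))
  have henter' : ∀ j, ∀ p ∈ P j, p ≠ v j (i₀ j) → p ≠ v j (i₁ j) →
      RayEnters (P j) u p ∨ RayEnters (P j) (-u) p := fun j => by rw [hP]; exact henter j
  have hvV : ∀ j i, v j i ∈ V j := fun j i => Finset.mem_image_of_mem _ (Finset.mem_univ i)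
  let J : Plane → Finset (Fin N) := fun p => Finset.univ.filter fun j => p ∈ V j
  have hJ : ∀ p j, j ∈ J p ↔ p ∈ (P j).extremePoints ℝ := fun p j => by simp [J, hVext]
  have hother : ∀ p j, p ∈ P j → j ∉ J p → RayEnters (P j) u p ∨ RayEnters (P j) (-u) p := by
    intro p j hp hj
    have hpV : p ∉ V j := by simpa [J] using hj
    exact henter' j p hp (fun h => hpV (h ▸ hvV j _)) (fun h => hpV (h ▸ hvV j _))
  obtain ⟨C, hCcard, hCext, hCmid, hCray⟩ := hR.exists_corners
  -- An extreme point of `R` is extreme in every subset of `R` containing it, in particular in a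
  -- tile.
  have hCJ : ∀ p ∈ C, ∃ j, j ∈ J p := by
    intro p hp
    have hpR := (hCext p).1 hp
    obtain ⟨j, hj⟩ := Set.mem_iUnion.1 (htile ▸ hpR.1)
    exact ⟨j, (hJ p j).2 (inter_extremePoints_subset_extremePoints_of_subset (hsub j) ⟨hj, hpR⟩)⟩
  have hCS : C ⊆ S := fun p hp => by
    obtain ⟨j, hj⟩ := hCJ p hp
    exact hVS j (by simpa [J] using hj)
  let F : Plane → ℤ := fun p =>
    ∑ j ∈ J p, (2 - 3 * (rayCount (P j) u p + rayCount (P j) (-u) p))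
  have hF : ∀ p, F p = 2 * ((J p).card : ℤ) -
      3 * (∑ j ∈ J p, rayCount (P j) u p + ∑ j ∈ J p, rayCount (P j) (-u) p) := by
    intro p
    simp only [F]
    rw [Finset.sum_sub_distrib, ← Finset.mul_sum, Finset.sum_add_distrib, Finset.sum_const,
      nsmul_eq_mul, mul_comm]
  have hF0 : ∀ p ∈ S, p ∉ C → 0 ≤ F p := by
    intro p hp hpC
    obtain ⟨j, -, hj⟩ := Finset.mem_biUnion.1 hp
    obtain ⟨d, hd, h1, h2⟩ := hCmid p (hsub j ((hVext j p).1 hj).1) hpC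
    have := three_mul_sum_rayCount_le hR.convex htile.le hcl hconv hint hdisj hsub hd h1 h2 (hJ p)
      (hother p)
    rw [hF]
    omega
  have hFC : ∀ p ∈ C, 2 - 3 * (rayCount R u p + rayCount R (-u) p) ≤ F p := by
    intro p hp
    have hle : ∀ w, ∑ j ∈ J p, rayCount (P j) w p ≤ rayCount R w p := fun w =>
      sum_rayCount_le (fun j _ => hsub j) fun i hi j hj =>
        eq_of_rayEnters hconv hdisj ((hJ p i).1 hi).1 ((hJ p j).1 hj).1
    have h1 := hle u
    have h2 := hle (-u)
    have h3 : 0 < (J p).card := Finset.card_pos.2 (hCJ p hp)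
    rw [hF]
    omega
  have hcorner : ∀ w, ∑ p ∈ C, rayCount R w p ≤ 1 := by
    intro w
    by_cases h : ∃ p ∈ C, RayEnters R w p
    · obtain ⟨p, hp, hpe⟩ := h
      rw [Finset.sum_eq_single_of_mem p hp fun p' hp' hne =>
        rayCount_of_not_rayEnters fun he => hne (hCray w p' hp' p hp he hpe)]
      exact rayCount_le_one _ _ _
    · push Not at h
      rw [Finset.sum_eq_zero fun p hp => rayCount_of_not_rayEnters (h p hp)]
      exact zero_le_one
  -- Four corners give 4·2, less 3 for each of the two directions.
  have hlower : 2 ≤ ∑ p ∈ S, F p := by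
    have h1 : ∑ p ∈ C, F p ≤ ∑ p ∈ S, F p :=
      Finset.sum_le_sum_of_subset_of_nonneg hCS hF0
    have h2 := Finset.sum_le_sum hFC
    rw [Finset.sum_sub_distrib, ← Finset.mul_sum, Finset.sum_add_distrib, Finset.sum_const,
      hCcard] at h2
    have h3 := hcorner u
    have h4 := hcorner (-u)
    simp only [nsmul_eq_mul, Nat.cast_ofNat] at h2
    omega
  have hswap : ∑ p ∈ S, F p =
      ∑ j, ∑ p ∈ V j, (2 - 3 * (rayCount (P j) u p + rayCount (P j) (-u) p)) := by
    refine Finset.sum_comm' fun p j => ?_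
    constructor
    · rintro ⟨-, hj⟩
      exact ⟨by simpa [J] using hj, Finset.mem_univ j⟩
    · rintro ⟨hp, -⟩
      exact ⟨hVS j hp, by simpa [J] using hp⟩
  have hupper : ∑ p ∈ S, F p ≤ 0 := by
    rw [hswap]
    exact Finset.sum_nonpos fun j _ => sum_vertices_le hq (hVcard j) fun p hp =>
      henter' j p ((hVext j p).1 hp).1
  omega
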